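/- Let $(X,\|\cdot\|)$ be a (real or complex) Banach space and let $p\in[1,2]$. For $n\in\mathbb N$ let $\mathbb E_\varepsilon$ denote the average over all $\varepsilon=(\varepsilon_1,\dots,\varepsilon_n)\in\{-1,1\}^n$. The space $X$ has Rademacher type $p$ with constant $T\in[0,\infty)$ if for every $n$ and all $x_1,\dots,x_n\in X$, $$\mathbb E_\varepsilon\Bigl\|\sum_{j=1}^n\varepsilon_jx_j\Bigr\|^p\le T^p\sum_{j=1}^n\|x_j\|^p ,$$ and it has Rademacher type $p$ if this holds for some finite $T$. Let $T_p(X)\in[0,\infty]$ be the infimum of all such $T$ ($\infty$ if there is none). A metric space $(\mathcal M,d)$ has scaled Enflo type $p$ with constant $\tau\in[0,\infty)$ if for every $n$ there is a positive even integer $m$ such that for every $f:\mathbb Z_m^n\to\mathcal M$, where $\mathbb Z_m=\mathbb Z/m\mathbb Z$, $$\mathbb E_\varepsilon\int_{\mathbb Z_m^n}d\bigl(f(x+\tfrac m2\varepsilon),f(x)\bigr)^p\,d\mu(x)\le\tau^pm^p\sum_{j=1}^n\int_{\mathbb Z_m^n}d\bigl(f(x+e_j),f(x)\bigr)^p\,d\mu(x),$$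 with $\mu$ the uniform probability measure on $\mathbb Z_m^n$ and $e_1,\dots,e_n$ the standard basis vectors; it has scaled Enflo type $p$ if this holds for some finite $\tau$. Let $\tau_p(\mathcal M)\in[0,\infty]$ be the infimum of all such $\tau$ ($\infty$ if there is none). Then $X$, with the metric $d(x,y)=\|x-y\|$, has scaled Enflo type $p$ if and only if it has Rademacher type $p$. More precisely, $$\frac1{2\pi}\,T_p(X)\le\tau_p(X)\le5\,T_p(X).$$ -/

import Mathlib

open scoped NNReal ENNReal BigOperators

/-- The normed group `X` has Rademacher type `p` with constant `T`: for all `x₁, …, xₙ`,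
`𝔼_ε ‖∑ ε_j x_j‖ ^ p ≤ T ^ p ∑ ‖x_j‖ ^ p`, where `ε` is uniform on `{-1, 1}ⁿ`
(the units of `ℤ` being `1` and `-1`). -/
def HasRademacherTypeWith (X : Type*) [NormedAddCommGroup X] (p : ℝ) (T : ℝ≥0) : Prop :=
  ∀ (n : ℕ) (x : Fin n → X),
    (𝔼 ε : Fin n → ℤˣ, ‖∑ j, (ε j : ℤ) • x j‖ ^ p) ≤ (T : ℝ) ^ p * ∑ j, ‖x j‖ ^ p

/-- `X` has Rademacher type `p`. -/
def HasRademacherType (X : Type*) [NormedAddCommGroup X] (p : ℝ) : Prop :=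
  ∃ T : ℝ≥0, HasRademacherTypeWith X p T

/-- The constant `T_p(X)`, the infimum of the admissible constants (`∞` if there is none). -/
noncomputable def rademacherTypeConst (X : Type*) [NormedAddCommGroup X] (p : ℝ) : ℝ≥0∞ :=
  ⨅ (T : ℝ≥0) (_ : HasRademacherTypeWith X p T), (T : ℝ≥0∞)

/-- The metric space `M` has scaled Enflo type `p` with constant `τ`: for every `n` there is a
positive even integer `m` such that every `f : (ℤ/m)ⁿ → M` satisfies the scaled Enflo inequality;
`ε` is uniform on `{-1, 1}ⁿ` and `x` is uniform on `(ℤ/m)ⁿ`. -/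
def HasScaledEnfloTypeWith (M : Type*) [MetricSpace M] (p : ℝ) (τ : ℝ≥0) : Prop :=
  ∀ n : ℕ, ∃ (m : ℕ) (_ : NeZero m), Even m ∧ ∀ f : (Fin n → ZMod m) → M,
    (𝔼 ε : Fin n → ℤˣ, 𝔼 x : Fin n → ZMod m,
        dist (f (x + fun j => ((m / 2 : ℕ) : ZMod m) * ((ε j : ℤ) : ZMod m))) (f x) ^ p) ≤
      (τ : ℝ) ^ p * (m : ℝ) ^ p *
        ∑ j, 𝔼 x : Fin n → ZMod m, dist (f (x + Pi.single j 1)) (f x) ^ p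

/-- `M` has scaled Enflo type `p`. -/
def HasScaledEnfloType (M : Type*) [MetricSpace M] (p : ℝ) : Prop :=
  ∃ τ : ℝ≥0, HasScaledEnfloTypeWith M p τ

/-- The constant `τ_p(M)`, the infimum of the admissible constants (`∞` if there is none). -/
noncomputable def scaledEnfloTypeConst (M : Type*) [MetricSpace M] (p : ℝ) : ℝ≥0∞ :=
  ⨅ (τ : ℝ≥0) (_ : HasScaledEnfloTypeWith M p τ), (τ : ℝ≥0∞)

/-!
Both implications hold with explicit constants: scaled Enflo type `p` with constant `τ` gives
Rademacher type `p` with constant `2πτ`, and Rademacher type `p` with constant `T` gives scaled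
Enflo type `p` with the same constant `T`, which is stronger than the required `5T`. Only the real
vector space structure of `X` matters, so complex scalars are restricted to `ℝ`.

For the first implication (`HasScaledEnfloTypeWith.hasRademacherTypeWith`), apply the Enflo
inequality to `f x = ∑ cos (2πx_j/m) v_j`. Since `f (x + (m/2)ε) = -f x`, the left side is
`2 ^ p 𝔼 ‖f‖ ^ p`, and the right side is at most `(2πτ) ^ p ∑ ‖v_j‖ ^ p`. The law of `f` does not
change when the cosines get arbitrary signs, so `𝔼 ‖f‖ ^ p` is the average of
`‖∑ ε_j |cos (2πx_j/m)| v_j‖ ^ p`; by Jensen, and because `|cos|` has mean at least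
`𝔼 cos ^ 2 ≥ 1/2`, this dominates `𝔼 ‖∑ ε_j v_j / 2‖ ^ p` (`expect_norm_sign_sum_rpow_le`).

For the second one (`HasRademacherTypeWith.hasScaledEnfloTypeWith`), work in the `ℓ^p` space of
functions `(ZMod m)ⁿ → X`, on which translations act isometrically. Replace `f` by its average `F`
over boxes of side `k` (`exists_smoothing`). The second differences of `F` are at most `2/k` times
the first differences of `f`, so a step `F (x + ε) - F x` is `∑ ε_j ∂_jF x` up to an error of order
`n²/k` (`norm_lpTranslate_sum_sub_linearization_le`), and the Rademacher type of `X` controls the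
sum. Telescoping over the `m/2` steps from `x` to `x + (m/2)ε` gives the inequality for `F` with
main term `(m/2) T`; passing from `f` to `F` costs `2kn`, which is negligible when `m` is a large
multiple of `kn`. As `T ≥ 1` when `X` is nontrivial, all errors are absorbed in the factor
`m T`.
-/

/-! ### Translations and smoothing in `ℓ^q(G, X)` -/

section Translation

variable {G X : Type*} [AddCommGroup G] [Fintype G] [NormedAddCommGroup X] [NormedSpace ℝ X]
  {q : ℝ≥0∞} [Fact (1 ≤ q)]

/-- Translation by `z` as an isometry of the `ℓ^q` space of functions `G → X`. -/
noncomputable def lpTranslate (z : G) :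
    PiLp q (fun _ : G => X) →ₗᵢ[ℝ] PiLp q (fun _ : G => X) :=
  (LinearIsometryEquiv.piLpCongrLeft q ℝ X (Equiv.subRight z)).toLinearIsometry

@[simp] theorem lpTranslate_apply (z : G) (g : PiLp q (fun _ : G => X)) (x : G) :
    lpTranslate z g x = g (x + z) := by
  simp [lpTranslate, LinearIsometryEquiv.piLpCongrLeft_apply]

theorem lpTranslate_add (a b : G) (g : PiLp q (fun _ : G => X)) :
    lpTranslate (a + b) g = lpTranslate a (lpTranslate b g) := by
  ext x; simp [add_assoc]

theorem lpTranslate_zero (g : PiLp q (fun _ : G => X)) : lpTranslate (0 : G) g = g := by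
  ext x; simp

theorem lpTranslate_comm (a b : G) (g : PiLp q (fun _ : G => X)) :
    lpTranslate a (lpTranslate b g) = lpTranslate b (lpTranslate a g) := by
  rw [← lpTranslate_add, add_comm, lpTranslate_add]

theorem norm_lpTranslate_add_sub_le (a b : G) (g : PiLp q (fun _ : G => X)) :
    ‖lpTranslate (a + b) g - g‖ ≤ ‖lpTranslate a g - g‖ + ‖lpTranslate b g - g‖ := by
  have h : lpTranslate (a + b) g - g = lpTranslate a (lpTranslate b g - g) + (lpTranslate a g - g) := by
    rw [lpTranslate_add, map_sub]; abel
  rw [h, add_comm ‖lpTranslate a g - g‖]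
  exact (norm_add_le _ _).trans_eq (by rw [LinearIsometry.norm_map])

theorem norm_lpTranslate_neg_sub (a : G) (g : PiLp q (fun _ : G => X)) :
    ‖lpTranslate (-a) g - g‖ = ‖lpTranslate a g - g‖ := by
  rw [← LinearIsometry.norm_map (lpTranslate a), map_sub, ← lpTranslate_add, add_neg_cancel,
    lpTranslate_zero, norm_sub_rev]

theorem norm_lpTranslate_nsmul_sub_le (t : ℕ) (a : G) (g : PiLp q (fun _ : G => X)) :
    ‖lpTranslate (t • a) g - g‖ ≤ t * ‖lpTranslate a g - g‖ := by
  induction t with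
  | zero => simp [lpTranslate_zero]
  | succ t ih =>
    rw [succ_nsmul]
    refine (norm_lpTranslate_add_sub_le _ _ _).trans ?_
    push_cast
    linarith

theorem norm_lpTranslate_units_smul_sub (u : ℤˣ) (a : G) (g : PiLp q (fun _ : G => X)) :
    ‖lpTranslate ((u : ℤ) • a) g - g‖ = ‖lpTranslate a g - g‖ := by
  rcases Int.units_eq_one_or u with rfl | rfl
  · simp
  · simpa using norm_lpTranslate_neg_sub a g

theorem norm_lpTranslate_sum_units_smul_sub_le {ι : Type*} (s : Finset ι) (e : ι → G) (ε : ι → ℤˣ)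
    (g : PiLp q (fun _ : G => X)) {η : ℝ} (h : ∀ i ∈ s, ‖lpTranslate (e i) g - g‖ ≤ η) :
    ‖lpTranslate (∑ i ∈ s, (ε i : ℤ) • e i) g - g‖ ≤ s.card * η := by
  classical
  induction s using Finset.induction_on with
  | empty => simp [lpTranslate_zero]
  | insert a s ha ih =>
    rw [Finset.sum_insert ha, Finset.card_insert_of_notMem ha]
    refine (norm_lpTranslate_add_sub_le _ _ _).trans ?_
    rw [norm_lpTranslate_units_smul_sub]
    have h1 := h a (Finset.mem_insert_self _ _)
    have h2 := ih fun i hi => h i (Finset.mem_insert_of_mem hi)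
    push_cast
    linarith

/-- A step along a sign vector is, up to second differences, the signed sum of the first
differences. -/
theorem norm_lpTranslate_sum_sub_linearization_le {ι : Type*} (s : Finset ι) (e : ι → G)
    (ε : ι → ℤˣ) (F : PiLp q (fun _ : G => X)) {η : ℝ} (hη : 0 ≤ η)
    (h : ∀ i ∈ s, ∀ j ∈ s,
      ‖lpTranslate (e i) (lpTranslate (e j) F - F) - (lpTranslate (e j) F - F)‖ ≤ η) :
    ‖lpTranslate (∑ i ∈ s, (ε i : ℤ) • e i) F - F - ∑ i ∈ s, (ε i : ℤ) • (lpTranslate (e i) F - F)‖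
      ≤ s.card ^ 2 * η := by
  classical
  induction s using Finset.induction_on with
  | empty => simp [lpTranslate_zero]
  | insert a s ha ih =>
    have hih := ih fun i hi j hj =>
      h i (Finset.mem_insert_of_mem hi) j (Finset.mem_insert_of_mem hj)
    rw [Finset.sum_insert ha, Finset.sum_insert ha, Finset.card_insert_of_notMem ha]
    set w := ∑ i ∈ s, (ε i : ℤ) • e i
    set D := lpTranslate (e a) F - F with hD
    set Q := ∑ i ∈ s, (ε i : ℤ) • (lpTranslate (e i) F - F)
    have hw : ‖lpTranslate w D - D‖ ≤ s.card * η :=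
      norm_lpTranslate_sum_units_smul_sub_le s e ε D fun i hi =>
        h i (Finset.mem_insert_of_mem hi) a (Finset.mem_insert_self _ _)
    have ha' : ‖lpTranslate (e a) D - D‖ ≤ η :=
      h a (Finset.mem_insert_self _ _) a (Finset.mem_insert_self _ _)
    have hstep : ‖lpTranslate w (lpTranslate ((ε a : ℤ) • e a) F - F) - (ε a : ℤ) • D‖
        ≤ (s.card + 1) * η := by
      rcases Int.units_eq_one_or (ε a) with h1 | h1
      · simp only [h1, Units.val_one, one_smul]
        linarith
      · have h2 : lpTranslate (-e a) F - F = -lpTranslate (-e a) D := by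
          rw [hD, map_sub, ← lpTranslate_add, neg_add_cancel, lpTranslate_zero]; abel
        have h3 : ‖lpTranslate (w + -e a) D - D‖ ≤ s.card * η + η := by
          refine (norm_lpTranslate_add_sub_le _ _ _).trans ?_
          rw [norm_lpTranslate_neg_sub]
          exact add_le_add hw ha'
        simp only [h1, Units.val_neg, Units.val_one, neg_smul, one_smul]
        rw [h2, map_neg, ← lpTranslate_add, ← norm_neg]
        convert h3 using 1
        · congr 1; abel
        · ring
    have hsplit : lpTranslate ((ε a : ℤ) • e a + w) F - F - ((ε a : ℤ) • D + Q)
        = (lpTranslate w F - F - Q)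
          + (lpTranslate w (lpTranslate ((ε a : ℤ) • e a) F - F) - (ε a : ℤ) • D) := by
      rw [add_comm _ w, lpTranslate_add, map_sub]; abel
    rw [hsplit]
    refine (norm_add_le _ _).trans ((add_le_add hih hstep).trans ?_)
    push_cast
    nlinarith [mul_nonneg (Nat.cast_nonneg (α := ℝ) s.card) hη]

/-- The average of the first `k` iterates of the translation by `z`. -/
noncomputable def averageTranslates (z : G) (k : ℕ) :
    PiLp q (fun _ : G => X) →ₗ[ℝ] PiLp q (fun _ : G => X) :=
  (k : ℝ)⁻¹ • ∑ t ∈ Finset.range k, (lpTranslate (t • z)).toLinearMap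

theorem averageTranslates_apply (z : G) (k : ℕ) (g : PiLp q (fun _ : G => X)) :
    averageTranslates z k g = (k : ℝ)⁻¹ • ∑ t ∈ Finset.range k, lpTranslate (t • z) g := by
  simp [averageTranslates, LinearMap.sum_apply]

theorem averageTranslates_lpTranslate (a z : G) (k : ℕ) (g : PiLp q (fun _ : G => X)) :
    averageTranslates z k (lpTranslate a g) = lpTranslate a (averageTranslates z k g) := by
  simp only [averageTranslates_apply, map_smul, map_sum, lpTranslate_comm a]

theorem norm_averageTranslates_le (z : G) {k : ℕ} (hk : 0 < k) (g : PiLp q (fun _ : G => X)) :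
    ‖averageTranslates z k g‖ ≤ ‖g‖ := by
  have hk' : (0 : ℝ) < k := by exact_mod_cast hk
  rw [averageTranslates_apply, norm_smul, norm_inv, Real.norm_natCast, inv_mul_le_iff₀ hk']
  refine (norm_sum_le _ _).trans_eq ?_
  simp

/-- The average is almost invariant: its difference in the direction `z` telescopes. -/
theorem norm_lpTranslate_averageTranslates_sub_le (z : G) (k : ℕ) (g : PiLp q (fun _ : G => X)) :
    ‖lpTranslate z (averageTranslates z k g) - averageTranslates z k g‖ ≤ 2 / k * ‖g‖ := by
  have h : lpTranslate z (averageTranslates z k g) - averageTranslates z k g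
      = (k : ℝ)⁻¹ • (lpTranslate (k • z) g - g) := by
    have h2 := Finset.sum_range_sub (fun t : ℕ => lpTranslate (t • z) g) k
    rw [zero_smul, lpTranslate_zero] at h2
    rw [← h2, averageTranslates_apply, map_smul, ← smul_sub, map_sum, ← Finset.sum_sub_distrib]
    simp only [← lpTranslate_add, succ_nsmul']
  rw [h, norm_smul, norm_inv, Real.norm_natCast, div_eq_inv_mul, mul_assoc]
  gcongr
  refine (norm_sub_le _ _).trans_eq ?_
  rw [LinearIsometry.norm_map, two_mul]

theorem norm_averageTranslates_sub_le (z : G) {k : ℕ} (hk : 0 < k)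
    (g : PiLp q (fun _ : G => X)) :
    ‖averageTranslates z k g - g‖ ≤ k * ‖lpTranslate z g - g‖ := by
  have hk' : (0 : ℝ) < k := by exact_mod_cast hk
  have h : averageTranslates z k g - g
      = (k : ℝ)⁻¹ • ∑ t ∈ Finset.range k, (lpTranslate (t • z) g - g) := by
    rw [averageTranslates_apply, Finset.sum_sub_distrib, smul_sub, Finset.sum_const,
      Finset.card_range, ← Nat.cast_smul_eq_nsmul ℝ, smul_smul, inv_mul_cancel₀ hk'.ne', one_smul]
  rw [h, norm_smul, norm_inv, Real.norm_natCast, inv_mul_le_iff₀ hk']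
  refine (norm_sum_le _ _).trans ?_
  refine (Finset.sum_le_card_nsmul _ _ (k * ‖lpTranslate z g - g‖) fun t ht => ?_).trans_eq
    (by simp)
  refine (norm_lpTranslate_nsmul_sub_le t z g).trans ?_
  have : (t : ℝ) ≤ k := by exact_mod_cast (Finset.mem_range.1 ht).le
  gcongr

/-- Averaging over a box of side `k` spanned by the `e i` yields a contraction that commutes with
translations, is nearly invariant in every direction `e i`, and moves `g` by at most `k` times the
sum of the first differences of `g`. -/
theorem exists_smoothing {ι : Type*} (e : ι → G) {k : ℕ} (hk : 0 < k) (s : Finset ι) :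
    ∃ S : PiLp q (fun _ : G => X) →ₗ[ℝ] PiLp q (fun _ : G => X),
      (∀ g, ‖S g‖ ≤ ‖g‖) ∧ (∀ z g, S (lpTranslate z g) = lpTranslate z (S g)) ∧
      (∀ i ∈ s, ∀ g, ‖lpTranslate (e i) (S g) - S g‖ ≤ 2 / k * ‖g‖) ∧
      ∀ g, ‖S g - g‖ ≤ k * ∑ i ∈ s, ‖lpTranslate (e i) g - g‖ := by
  classical
  induction s using Finset.induction_on with
  | empty => exact ⟨LinearMap.id, by simp⟩
  | insert a s ha ih =>
    obtain ⟨S, hS, hcomm, hinv, hmove⟩ := ih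
    refine ⟨S ∘ₗ averageTranslates (e a) k, fun g => ?_, fun z g => ?_, fun i hi g => ?_,
      fun g => ?_⟩
    · exact (hS _).trans (norm_averageTranslates_le _ hk g)
    · simp only [LinearMap.comp_apply, averageTranslates_lpTranslate, hcomm]
    · simp only [LinearMap.comp_apply]
      rcases Finset.mem_insert.1 hi with rfl | hi
      · rw [← hcomm, ← map_sub]
        exact (hS _).trans (norm_lpTranslate_averageTranslates_sub_le _ _ _)
      · refine (hinv i hi _).trans ?_
        gcongr
        exact norm_averageTranslates_le _ hk g
    · have h : (S ∘ₗ averageTranslates (e a) k) g - g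
          = S (averageTranslates (e a) k g - g) + (S g - g) := by
        simp
      rw [h, Finset.sum_insert ha, mul_add]
      refine (norm_add_le _ _).trans (add_le_add ?_ (hmove g))
      exact (hS _).trans (norm_averageTranslates_sub_le _ hk g)

end Translation

/-! ### From scaled Enflo type to Rademacher type -/

section LowerBound

/-- The real part of the standard character `x ↦ exp (2πix/m)` of `ZMod m`. -/
noncomputable def zmodCos {m : ℕ} [NeZero m] (x : ZMod m) : ℝ := (ZMod.stdAddChar x : ℂ).re

variable {m : ℕ} [NeZero m]

theorem norm_stdAddChar (x : ZMod m) : ‖(ZMod.stdAddChar x : ℂ)‖ = 1 := by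
  rw [ZMod.stdAddChar_apply]; exact Circle.norm_coe _

theorem abs_zmodCos_le_one (x : ZMod m) : |zmodCos x| ≤ 1 :=
  (Complex.abs_re_le_norm _).trans_eq (norm_stdAddChar x)

theorem abs_zmodCos_add_one_sub_le (x : ZMod m) :
    |zmodCos (x + 1) - zmodCos x| ≤ 2 * Real.pi / m := by
  have h1 : zmodCos (x + 1) - zmodCos x
      = ((ZMod.stdAddChar x : ℂ) * (ZMod.stdAddChar (1 : ZMod m) - 1)).re := by
    rw [zmodCos, zmodCos, AddChar.map_add_eq_mul, ← Complex.sub_re]; ring_nf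
  have h2 : (ZMod.stdAddChar (1 : ZMod m) : ℂ)
      = Complex.exp (Complex.I * ((2 * Real.pi / m : ℝ) : ℂ)) := by
    have := ZMod.stdAddChar_coe (N := m) 1
    rw [Int.cast_one] at this
    rw [this]; congr 1; push_cast; ring
  rw [h1]
  refine (Complex.abs_re_le_norm _).trans ?_
  rw [norm_mul, norm_stdAddChar, one_mul, h2]
  refine Real.norm_exp_I_mul_ofReal_sub_one_le.trans_eq ?_
  rw [Real.norm_of_nonneg (by positivity)]

theorem zmodCos_add_half (hm : Even m) (x : ZMod m) :
    zmodCos (x + ((m / 2 : ℕ) : ZMod m)) = -zmodCos x := by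
  have hm0 : (m : ℂ) ≠ 0 := by exact_mod_cast NeZero.ne m
  have h : (ZMod.stdAddChar ((m / 2 : ℕ) : ZMod m) : ℂ) = -1 := by
    have := ZMod.stdAddChar_coe (N := m) ((m / 2 : ℕ) : ℤ)
    rw [Int.cast_natCast] at this
    rw [this, ← Complex.exp_pi_mul_I]
    congr 1
    have h2 : ((m / 2 : ℕ) : ℂ) = m / 2 := by
      rw [Nat.cast_div hm.two_dvd (by norm_num)]; norm_num
    rw [Int.cast_natCast, h2]
    field_simp
  rw [zmodCos, AddChar.map_add_eq_mul, h, mul_neg_one, Complex.neg_re, zmodCos]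

theorem zmodCos_sq (x : ZMod m) : zmodCos x ^ 2 = (1 + zmodCos (x + x)) / 2 := by
  have h := norm_stdAddChar x
  rw [← sq_eq_sq₀ (norm_nonneg _) zero_le_one, ← Complex.normSq_eq_norm_sq,
    Complex.normSq_apply] at h
  rw [zmodCos, zmodCos, AddChar.map_add_eq_mul, Complex.mul_re]
  nlinarith

theorem expect_zmodCos_add_self_nonneg : 0 ≤ 𝔼 x : ZMod m, zmodCos (x + x) := by
  have h := AddChar.sum_mulShift (2 : ZMod m) (ZMod.isPrimitive_stdAddChar m)
  have h2 : ∑ x : ZMod m, zmodCos (x + x)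
      = (∑ x : ZMod m, (ZMod.stdAddChar (x * 2) : ℂ)).re := by
    simp only [Complex.re_sum, zmodCos, mul_two]
  rw [Fintype.expect_eq_sum_div_card, h2, h, Complex.natCast_re]
  positivity

/-- The mean of `|cos|` is at least that of `cos ^ 2`, hence at least `1 / 2`. -/
theorem half_le_expect_abs_zmodCos : 1 / 2 ≤ 𝔼 x : ZMod m, |zmodCos x| := by
  have h1 : (𝔼 x : ZMod m, zmodCos x ^ 2) ≤ 𝔼 x : ZMod m, |zmodCos x| :=
    Finset.expect_le_expect fun x _ => by
      rw [← sq_abs]; nlinarith [abs_nonneg (zmodCos x), abs_zmodCos_le_one x]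
  have h2 : (𝔼 x : ZMod m, zmodCos x ^ 2) = 1 / 2 + (1 / 2) * 𝔼 x : ZMod m, zmodCos (x + x) := by
    rw [Finset.mul_expect, ← Fintype.expect_const (ι := ZMod m) (1 / 2 : ℝ),
      ← Finset.expect_add_distrib, Fintype.expect_const]
    refine Finset.expect_congr rfl fun x _ => ?_
    rw [zmodCos_sq]; ring
  linarith [expect_zmodCos_add_self_nonneg (m := m)]

/-- The coordinates of a uniform random point of a product are uniform. -/
theorem expect_apply_eq {ι A : Type*} [Fintype ι] [DecidableEq ι] [AddCommGroup A] [Fintype A]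
    (g : A → ℝ) (j : ι) : (𝔼 x : ι → A, g (x j)) = 𝔼 a : A, g a := by
  -- Average over the translates of `x` in the `j`-th direction.
  calc (𝔼 x : ι → A, g (x j)) = 𝔼 t : A, 𝔼 x : ι → A, g (x j + t) := by
        rw [← Fintype.expect_const (ι := A) (𝔼 x : ι → A, g (x j))]
        refine Finset.expect_congr rfl fun t _ => ?_
        exact (Fintype.expect_equiv (Equiv.addRight (Pi.single j t : ι → A)) _ _
          (fun x => by simp)).symm
    _ = 𝔼 x : ι → A, 𝔼 t : A, g (x j + t) := Finset.expect_comm _ _ _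
    _ = 𝔼 _x : ι → A, 𝔼 a : A, g a := by
        refine Finset.expect_congr rfl fun x _ => ?_
        exact Fintype.expect_equiv (Equiv.addLeft (x j)) _ _ fun t => rfl
    _ = 𝔼 a : A, g a := Fintype.expect_const _

variable {X : Type*} [NormedAddCommGroup X] [NormedSpace ℝ X]

/-- Jensen's inequality for `‖·‖ ^ p` and the uniform measure on a finite type. -/
theorem norm_expect_rpow_le {ι : Type*} [Fintype ι] [Nonempty ι] {p : ℝ} (hp : 1 ≤ p)
    (f : ι → X) : ‖(Fintype.card ι : ℝ)⁻¹ • ∑ i, f i‖ ^ p ≤ 𝔼 i, ‖f i‖ ^ p := by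
  have hc : (0 : ℝ) < Fintype.card ι := by exact_mod_cast Fintype.card_pos
  have h := Real.rpow_arith_mean_le_arith_mean_rpow Finset.univ
    (fun _ : ι => (Fintype.card ι : ℝ)⁻¹) (fun i => ‖f i‖) (fun _ _ => by positivity)
    (by simp [hc.ne']) (fun _ _ => norm_nonneg _) hp
  rw [← Finset.mul_sum, ← Finset.mul_sum] at h
  rw [Fintype.expect_eq_sum_div_card, div_eq_inv_mul]
  refine le_trans ?_ h
  refine Real.rpow_le_rpow (norm_nonneg _) ?_ (by linarith)
  rw [norm_smul, norm_inv, Real.norm_natCast]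
  gcongr
  exact norm_sum_le _ _

/-- The trigonometric sum `∑ cos (2πx_j/m) v_j` dominates the Rademacher sum `∑ ε_j v_j / 2` in
`L^p`: it is invariant under sign changes of the cosines, so these may be replaced by
`ε_j |cos|`, and Jensen's inequality replaces `|cos|` by its mean, which is at least `1 / 2`. -/
theorem expect_norm_sign_sum_rpow_le {p : ℝ} (hp : 1 ≤ p) (hm : Even m) {n : ℕ} (v : Fin n → X) :
    (𝔼 ε : Fin n → ℤˣ, ‖∑ j, (ε j : ℤ) • v j‖ ^ p) ≤
      2 ^ p * 𝔼 x : Fin n → ZMod m, ‖∑ j, zmodCos (x j) • v j‖ ^ p := by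
  have hp0 : 0 ≤ p := by linarith
  set a : ℝ := 𝔼 x : ZMod m, |zmodCos x| with ha
  have ha2 : 1 / 2 ≤ a := half_le_expect_abs_zmodCos
  have hsign : ∀ ε : Fin n → ℤˣ,
      (𝔼 x : Fin n → ZMod m, ‖∑ j, (ε j : ℤ) • zmodCos (x j) • v j‖ ^ p)
        = 𝔼 x : Fin n → ZMod m, ‖∑ j, zmodCos (x j) • v j‖ ^ p := by
    intro ε
    refine Fintype.expect_equiv
      (Equiv.addRight fun j => if ε j = 1 then 0 else ((m / 2 : ℕ) : ZMod m)) _ _ fun x => ?_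
    congr 2
    refine Finset.sum_congr rfl fun j _ => ?_
    rcases Int.units_eq_one_or (ε j) with h | h
    · simp [h]
    · have : (-1 : ℤˣ) ≠ 1 := by decide
      simp [h, this, zmodCos_add_half hm]
  have habs : ∀ x : Fin n → ZMod m,
      (𝔼 ε : Fin n → ℤˣ, ‖∑ j, (ε j : ℤ) • |zmodCos (x j)| • v j‖ ^ p)
        = 𝔼 ε : Fin n → ℤˣ, ‖∑ j, (ε j : ℤ) • zmodCos (x j) • v j‖ ^ p := by
    intro x
    refine Fintype.expect_equiv
      (Equiv.mulRight fun j => if 0 ≤ zmodCos (x j) then 1 else -1) _ _ fun ε => ?_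
    congr 2
    refine Finset.sum_congr rfl fun j _ => ?_
    by_cases h : 0 ≤ zmodCos (x j)
    · simp [h, abs_of_nonneg h]
    · simp [h, abs_of_neg (not_le.1 h)]
  have hjensen : ∀ ε : Fin n → ℤˣ, ‖∑ j, (ε j : ℤ) • v j‖ ^ p ≤
      2 ^ p * 𝔼 x : Fin n → ZMod m, ‖∑ j, (ε j : ℤ) • |zmodCos (x j)| • v j‖ ^ p := by
    intro ε
    have h1 := norm_expect_rpow_le hp
      fun x : Fin n → ZMod m => ∑ j, (ε j : ℤ) • |zmodCos (x j)| • v j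
    have h2 : (Fintype.card (Fin n → ZMod m) : ℝ)⁻¹ •
        ∑ x : Fin n → ZMod m, ∑ j, (ε j : ℤ) • |zmodCos (x j)| • v j
          = a • ∑ j, (ε j : ℤ) • v j := by
      rw [Finset.sum_comm, Finset.smul_sum, Finset.smul_sum]
      refine Finset.sum_congr rfl fun j _ => ?_
      have h3 := expect_apply_eq (fun y : ZMod m => |zmodCos y|) j
      rw [← ha, Fintype.expect_eq_sum_div_card, div_eq_inv_mul] at h3
      rw [← Finset.smul_sum, ← Finset.sum_smul, smul_comm (_ : ℝ)⁻¹, smul_smul, h3, smul_comm]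
    rw [h2] at h1
    refine le_trans ?_ (mul_le_mul_of_nonneg_left h1 (by positivity))
    rw [← Real.mul_rpow (by norm_num) (norm_nonneg _)]
    refine Real.rpow_le_rpow (norm_nonneg _) ?_ hp0
    rw [norm_smul, Real.norm_of_nonneg (by linarith)]
    nlinarith [norm_nonneg (∑ j, (ε j : ℤ) • v j)]
  calc (𝔼 ε : Fin n → ℤˣ, ‖∑ j, (ε j : ℤ) • v j‖ ^ p)
      ≤ 𝔼 ε : Fin n → ℤˣ, 2 ^ p *
          𝔼 x : Fin n → ZMod m, ‖∑ j, (ε j : ℤ) • |zmodCos (x j)| • v j‖ ^ p :=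
        Finset.expect_le_expect fun ε _ => hjensen ε
    _ = 2 ^ p * 𝔼 x : Fin n → ZMod m, ‖∑ j, zmodCos (x j) • v j‖ ^ p := by
        rw [← Finset.mul_expect, Finset.expect_comm, Finset.expect_congr rfl fun x _ => habs x,
          Finset.expect_comm, Finset.expect_congr rfl fun ε _ => hsign ε, Fintype.expect_const]

/-- Test the scaled Enflo inequality on `x ↦ ∑ cos (2πx_j/m) v_j`, which changes sign under
`x ↦ x + (m/2)ε` and is `2π/m ‖v_j‖`-Lipschitz in the `j`-th direction. -/
theorem HasScaledEnfloTypeWith.hasRademacherTypeWith {p : ℝ} (hp : 1 ≤ p) {τ : ℝ≥0}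
    (h : HasScaledEnfloTypeWith X p τ) :
    HasRademacherTypeWith X p (2 * Real.toNNReal Real.pi * τ) := by
  intro n v
  obtain ⟨m, _, hm, hf⟩ := h n
  have hp0 : 0 ≤ p := by linarith
  have hm0 : (0 : ℝ) < m := by exact_mod_cast Nat.pos_of_ne_zero (NeZero.ne m)
  have hpi := Real.pi_pos.le
  refine (expect_norm_sign_sum_rpow_le hp hm v).trans ?_
  have h1 := hf fun x => ∑ j, zmodCos (x j) • v j
  -- Since `m` is even, `m/2 = -m/2` in `ZMod m`: the shift does not depend on `ε`.
  have hunit : ∀ u : ℤˣ,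
      ((m / 2 : ℕ) : ZMod m) * ((u : ℤ) : ZMod m) = ((m / 2 : ℕ) : ZMod m) := by
    intro u
    rcases Int.units_eq_one_or u with rfl | rfl
    · simp
    · have h2 : ((m / 2 : ℕ) : ZMod m) + ((m / 2 : ℕ) : ZMod m) = 0 := by
        rw [← Nat.cast_add, ← two_mul, Nat.mul_div_cancel' hm.two_dvd, ZMod.natCast_self]
      simpa using (eq_neg_of_add_eq_zero_left h2).symm
  have hlhs : ∀ x : Fin n → ZMod m,
      dist (∑ j, zmodCos (x j + ((m / 2 : ℕ) : ZMod m)) • v j) (∑ j, zmodCos (x j) • v j) ^ p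
        = 2 ^ p * ‖∑ j, zmodCos (x j) • v j‖ ^ p := by
    intro x
    simp only [zmodCos_add_half hm, neg_smul, Finset.sum_neg_distrib]
    rw [← Real.mul_rpow (by norm_num) (norm_nonneg _), dist_eq_norm, ← neg_add', norm_neg,
      ← two_smul ℝ, norm_smul, Real.norm_ofNat]
  simp only [Pi.add_apply, hunit, hlhs] at h1
  rw [Fintype.expect_const, ← Finset.mul_expect] at h1
  refine h1.trans ?_
  have hrhs : ∀ j, (𝔼 x : Fin n → ZMod m,
      dist (∑ i, zmodCos (x i + Pi.single (M := fun _ => ZMod m) j 1 i) • v i)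
        (∑ i, zmodCos (x i) • v i) ^ p) ≤ (2 * Real.pi / m) ^ p * ‖v j‖ ^ p := by
    intro j
    refine (Finset.expect_le_expect fun x _ => ?_).trans_eq (Fintype.expect_const _)
    rw [← Real.mul_rpow (by positivity) (norm_nonneg _)]
    refine Real.rpow_le_rpow dist_nonneg ?_ hp0
    rw [dist_eq_norm, ← Finset.sum_sub_distrib, Finset.sum_eq_single j]
    · rw [Pi.single_eq_same, ← sub_smul, norm_smul]
      gcongr
      exact abs_zmodCos_add_one_sub_le _
    · intro i _ hi
      simp [Pi.single_eq_of_ne hi]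
    · simp
  refine (mul_le_mul_of_nonneg_left (Finset.sum_le_sum fun j _ => hrhs j)
    (by positivity)).trans_eq ?_
  rw [← Finset.mul_sum, ← mul_assoc, ← Real.mul_rpow (by positivity) (by positivity),
    ← Real.mul_rpow (by positivity) (by positivity)]
  congr 2
  push_cast
  rw [Real.coe_toNNReal _ hpi]
  field_simp

end LowerBound

/-! ### Rademacher type and its `ℓ^p` extension -/


theorem PiLp.norm_rpow_eq_card_mul_expect {G X : Type*} [Fintype G] [Nonempty G]
    [NormedAddCommGroup X] {p : ℝ} (hp : 1 ≤ p)
    (g : PiLp (ENNReal.ofReal p) (fun _ : G => X)) :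
    ‖g‖ ^ p = Fintype.card G * 𝔼 x, ‖g x‖ ^ p := by
  have hp0 : 0 < p := by linarith
  have hc : (Fintype.card G : ℝ) ≠ 0 := by exact_mod_cast Fintype.card_ne_zero
  rw [PiLp.norm_eq_sum (by rw [ENNReal.toReal_ofReal hp0.le]; exact hp0),
    ENNReal.toReal_ofReal hp0.le, ← Real.rpow_mul (Finset.sum_nonneg fun _ _ => by positivity),
    one_div_mul_cancel hp0.ne', Real.rpow_one, Fintype.expect_eq_sum_div_card, mul_div_cancel₀ _ hc]

theorem add_rpow_le_two_mul {a b p : ℝ} (ha : 0 ≤ a) (hb : 0 ≤ b) (hp : 1 ≤ p) :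
    (a + b) ^ p ≤ 2 ^ p * ((a ^ p + b ^ p) / 2) := by
  have h := NNReal.rpow_add_le_mul_rpow_add_rpow ⟨a, ha⟩ ⟨b, hb⟩ hp
  have h' : (a + b) ^ p ≤ 2 ^ (p - 1) * (a ^ p + b ^ p) := by exact_mod_cast h
  rwa [Real.rpow_sub_one (by norm_num), div_mul_eq_mul_div, mul_div_assoc] at h'

theorem HasRademacherTypeWith.one_le {X : Type*} [NormedAddCommGroup X] [Nontrivial X]
    {p : ℝ} (hp : 1 ≤ p) {T : ℝ≥0}
    (h : HasRademacherTypeWith X p T) : 1 ≤ (T : ℝ) := by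
  obtain ⟨x, hx⟩ := exists_ne (0 : X)
  have h1 := h 1 fun _ => x
  have hu : ∀ u : ℤˣ, ‖(u : ℤ) • x‖ = ‖x‖ := fun u => by
    rcases Int.units_eq_one_or u with rfl | rfl <;> simp
  simp only [Fin.sum_univ_one, hu, Fintype.expect_const] at h1
  have hx0 : 0 < ‖x‖ ^ p := Real.rpow_pos_of_pos (norm_pos_iff.2 hx) p
  have h2 : 1 ≤ (T : ℝ) ^ p := by
    by_contra hlt
    nlinarith
  by_contra hlt
  exact absurd h2 (not_le.2 (Real.rpow_lt_one T.2 (not_le.1 hlt) (by linarith)))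

/-- Rademacher type `p` passes from `X` to the `ℓ^p` space of `X`-valued functions, with the same
constant: sum the inequality over the points. -/
theorem HasRademacherTypeWith.piLp {G X : Type*} [Fintype G] [Nonempty G]
    [NormedAddCommGroup X] {p : ℝ} (hp : 1 ≤ p) {T : ℝ≥0}
    (h : HasRademacherTypeWith X p T) [Fact (1 ≤ ENNReal.ofReal p)] :
    HasRademacherTypeWith (PiLp (ENNReal.ofReal p) (fun _ : G => X)) p T := by
  intro n v
  simp only [PiLp.norm_rpow_eq_card_mul_expect hp]
  rw [← Finset.mul_expect, ← Finset.mul_sum, mul_left_comm]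
  refine mul_le_mul_of_nonneg_left ?_ (Nat.cast_nonneg _)
  rw [Finset.expect_comm, ← Finset.expect_sum_comm, Finset.mul_expect]
  refine Finset.expect_le_expect fun x _ => ?_
  refine le_trans (le_of_eq ?_) (h n fun j => v j x)
  refine Finset.expect_congr rfl fun ε _ => ?_
  simp

/-! ### From Rademacher type to scaled Enflo type -/

section UpperBound

variable {G X : Type*} [AddCommGroup G] [Fintype G] [NormedAddCommGroup X] [NormedSpace ℝ X]

/-- For the smoothing `F` of `f` at scale `k`, a move of `N` steps along a sign vector `ε` changes
`f` by at most `N` times the Rademacher sum of the first differences of `F`, up to the cost of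
passing from `f` to `F` and of linearizing each step. -/
theorem exists_norm_lpTranslate_nsmul_sub_le {q : ℝ≥0∞} [Fact (1 ≤ q)] {ι : Type*} [Fintype ι]
    (e : ι → G) (f : PiLp q (fun _ : G => X)) {D : ℝ} (hD0 : 0 ≤ D)
    (hD : ∀ j, ‖lpTranslate (e j) f - f‖ ≤ D) {k : ℕ} (hk : 0 < k) :
    ∃ F : PiLp q (fun _ : G => X),
      (∀ j, ‖lpTranslate (e j) F - F‖ ≤ ‖lpTranslate (e j) f - f‖) ∧
      ∀ (ε : ι → ℤˣ) (N : ℕ), ‖lpTranslate (N • ∑ j, (ε j : ℤ) • e j) f - f‖ ≤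
        2 * (k * (Fintype.card ι * D)) + N * (Fintype.card ι ^ 2 * (2 / k * D)) +
          N * ‖∑ j, (ε j : ℤ) • (lpTranslate (e j) F - F)‖ := by
  obtain ⟨S, hS, hcomm, hinv, hmove⟩ := exists_smoothing (q := q) (X := X) e hk Finset.univ
  have hdiff : ∀ j, lpTranslate (e j) (S f) - S f = S (lpTranslate (e j) f - f) := fun j => by
    rw [map_sub, hcomm]
  refine ⟨S f, fun j => ?_, fun ε N => ?_⟩
  · rw [hdiff]; exact hS _
  set w := ∑ j, (ε j : ℤ) • e j
  have hFf : ‖S f - f‖ ≤ k * (Fintype.card ι * D) := by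
    refine (hmove f).trans ?_
    gcongr
    exact (Finset.sum_le_card_nsmul _ _ D fun j _ => hD j).trans_eq (by simp)
  have hstep := norm_lpTranslate_sum_sub_linearization_le Finset.univ e ε (S f)
    (η := 2 / k * D) (by positivity) fun i hi j _ => by
      rw [hdiff j]
      refine (hinv i hi _).trans ?_
      gcongr
      exact hD j
  rw [Finset.card_univ] at hstep
  have hw : ‖lpTranslate w (S f) - S f‖ ≤ Fintype.card ι ^ 2 * (2 / k * D) +
      ‖∑ j, (ε j : ℤ) • (lpTranslate (e j) (S f) - S f)‖ :=
    (norm_le_norm_sub_add _ _).trans (add_le_add hstep le_rfl)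
  have hsplit : lpTranslate (N • w) f - f = -lpTranslate (N • w) (S f - f) + (S f - f)
      + (lpTranslate (N • w) (S f) - S f) := by
    rw [map_sub]; abel
  rw [hsplit]
  refine (norm_add₃_le).trans ?_
  rw [norm_neg, LinearIsometry.norm_map]
  have hN := (norm_lpTranslate_nsmul_sub_le N w (S f)).trans
    (mul_le_mul_of_nonneg_left hw (Nat.cast_nonneg N))
  linarith

/-- With the smoothing scale `k = 8 n ^ 2 + 1` and the period `m = 16 k (n + 1)`, the error terms
of `exists_norm_lpTranslate_nsmul_sub_le` for `N = m / 2` steps are together at most `N` times the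
bound `D` on the first differences. -/
theorem scaled_error_le {n k N : ℕ} (hk : k = 8 * n ^ 2 + 1) (hN : N = 8 * k * (n + 1)) {D : ℝ}
    (hD : 0 ≤ D) :
    2 * ((k : ℝ) * (n * D)) + N * (n ^ 2 * (2 / k * D)) ≤ N * D := by
  have hk0 : (0 : ℝ) < k := by rw [hk]; positivity
  have hk' : (k : ℝ) = 8 * n ^ 2 + 1 := by rw [hk]; push_cast; ring
  have hN' : (N : ℝ) = 8 * k * (n + 1) := by rw [hN]; push_cast; ring
  have h1 : (n : ℝ) ^ 2 * (2 / k * D) ≤ D / 2 := by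
    rw [show (n : ℝ) ^ 2 * (2 / k * D) = (2 * n ^ 2 / k) * D by ring,
      div_eq_inv_mul D]
    refine mul_le_mul_of_nonneg_right ?_ hD
    rw [div_le_iff₀ hk0, hk']
    linarith [sq_nonneg (n : ℝ)]
  have h2 := mul_le_mul_of_nonneg_left h1 (Nat.cast_nonneg (α := ℝ) N)
  have h3 : 2 * ((k : ℝ) * (n * D)) ≤ N * (D / 2) := by
    rw [hN']
    nlinarith [mul_nonneg hk0.le hD, mul_nonneg (mul_nonneg hk0.le hD) (Nat.cast_nonneg (α := ℝ) n)]
  linarith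

/-- Rademacher type `p` implies scaled Enflo type `p` with the same constant: for a large enough
period, the smoothing and linearization errors are no larger than the main term, which is bounded
by type `p` applied to the first differences of the smoothed function. -/
theorem HasRademacherTypeWith.hasScaledEnfloTypeWith {p : ℝ} (hp : 1 ≤ p) {T : ℝ≥0}
    (h : HasRademacherTypeWith X p T) : HasScaledEnfloTypeWith X p T := by
  have hp0 : 0 < p := by linarith
  intro n
  -- Only the two equations for the scales are used, in `scaled_error_le`.
  obtain ⟨k, hk⟩ : ∃ k, k = 8 * n ^ 2 + 1 := ⟨_, rfl⟩
  obtain ⟨N, hN⟩ : ∃ N, N = 8 * k * (n + 1) := ⟨_, rfl⟩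
  have hk0 : 0 < k := by omega
  have hN0 : 0 < N := by rw [hN]; positivity
  have : NeZero (2 * N) := ⟨by omega⟩
  refine ⟨2 * N, inferInstance, even_two_mul N, fun f => ?_⟩
  -- The trivial space has type `p` with `T = 0`; otherwise `1 ≤ T`, and the error terms can be
  -- absorbed into the main term.
  rcases subsingleton_or_nontrivial X with hX | hX
  · have : ∀ x y : X, dist x y ^ p = 0 := fun x y => by
      rw [Subsingleton.elim x y, dist_self, Real.zero_rpow hp0.ne']
    simp [this]
  have hT := h.one_le hp
  have : Fact (1 ≤ ENNReal.ofReal p) := ⟨by simpa using hp⟩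
  set e : Fin n → (Fin n → ZMod (2 * N)) := fun j => Pi.single j 1 with he
  let g : PiLp (ENNReal.ofReal p) (fun _ : Fin n → ZMod (2 * N) => X) := WithLp.toLp _ f
  set c : ℝ := (Fintype.card (Fin n → ZMod (2 * N)) : ℝ) with hc
  have hc0 : 0 < c := by rw [hc]; exact_mod_cast Fintype.card_pos
  have hnorm : ∀ z, (𝔼 x, dist (f (x + z)) (f x) ^ p) = c⁻¹ * ‖lpTranslate z g - g‖ ^ p := by
    intro z
    rw [PiLp.norm_rpow_eq_card_mul_expect hp, ← hc, inv_mul_cancel_left₀ hc0.ne']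
    refine Finset.expect_congr rfl fun x _ => ?_
    simp [g, dist_eq_norm]
  have hvec : ∀ ε : Fin n → ℤˣ,
      (fun j => ((2 * N / 2 : ℕ) : ZMod (2 * N)) * ((ε j : ℤ) : ZMod (2 * N)))
        = N • ∑ j, (ε j : ℤ) • e j := by
    intro ε
    funext i
    rw [Nat.mul_div_cancel_left N two_pos, Pi.smul_apply, Finset.sum_apply,
      Finset.sum_eq_single i]
    · simp [he]
    · intro j _ hj
      simp [he, Pi.single_eq_of_ne hj.symm]
    · simp
  simp only [hvec, hnorm]
  rw [← Finset.mul_expect, ← Finset.mul_sum, mul_left_comm]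
  refine mul_le_mul_of_nonneg_left ?_ (by positivity)
  set A : ℝ := ∑ j, ‖lpTranslate (Pi.single j 1) g - g‖ ^ p with hA
  have hA0 : 0 ≤ A := Finset.sum_nonneg fun _ _ => by positivity
  set D : ℝ := A ^ p⁻¹ with hDdef
  have hD0 : 0 ≤ D := by positivity
  have hDp : D ^ p = A := Real.rpow_inv_rpow hA0 hp0.ne'
  have hD : ∀ j, ‖lpTranslate (e j) g - g‖ ≤ D := fun j => by
    rw [hDdef, Real.le_rpow_inv_iff_of_pos (norm_nonneg _) hA0 hp0, hA]
    exact Finset.single_le_sum (f := fun j => ‖lpTranslate (e j) g - g‖ ^ p)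
      (fun _ _ => by positivity) (Finset.mem_univ j)
  obtain ⟨F, hF, hmove⟩ := exists_norm_lpTranslate_nsmul_sub_le e g hD0 hD hk0
  have hrad := h.piLp hp n fun j => lpTranslate (e j) F - F
  have hFA : ∑ j, ‖lpTranslate (e j) F - F‖ ^ p ≤ A :=
    Finset.sum_le_sum fun j _ => Real.rpow_le_rpow (norm_nonneg _) (hF j) hp0.le
  have hTp : 0 ≤ (T : ℝ) ^ p := by positivity
  have hrad' := hrad.trans (mul_le_mul_of_nonneg_left hFA hTp)
  have hpoint : ∀ ε : Fin n → ℤˣ, ‖lpTranslate (N • ∑ j, (ε j : ℤ) • e j) g - g‖ ^ p ≤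
      (2 * N : ℝ) ^ p *
        (((T : ℝ) ^ p * A + ‖∑ j, (ε j : ℤ) • (lpTranslate (e j) F - F)‖ ^ p) / 2) := by
    intro ε
    have h1 := hmove ε N
    rw [Fintype.card_fin] at h1
    have h2 := scaled_error_le hk hN hD0
    have h3 : ‖lpTranslate (N • ∑ j, (ε j : ℤ) • e j) g - g‖ ≤
        N * (T * D + ‖∑ j, (ε j : ℤ) • (lpTranslate (e j) F - F)‖) := by
      have h4 : (N : ℝ) * D ≤ N * (T * D) := by
        gcongr
        exact le_mul_of_one_le_left hD0 hT
      linarith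
    refine (Real.rpow_le_rpow (norm_nonneg _) h3 hp0.le).trans ?_
    rw [Real.mul_rpow (by positivity) (by positivity), ← hDp,
      ← Real.mul_rpow T.coe_nonneg hD0, mul_comm (2 : ℝ), Real.mul_rpow (by positivity) (by norm_num),
      mul_assoc]
    exact mul_le_mul_of_nonneg_left (add_rpow_le_two_mul (by positivity) (norm_nonneg _) hp)
      (by positivity)
  refine (Finset.expect_le_expect fun ε _ => hpoint ε).trans ?_
  rw [← Finset.mul_expect, ← Finset.expect_div, Finset.expect_add_distrib, Fintype.expect_const]
  push_cast
  calc _ ≤ (2 * N : ℝ) ^ p * (((T : ℝ) ^ p * A + (T : ℝ) ^ p * A) / 2) := by gcongr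
    _ = _ := by ring

end UpperBound

theorem theorem1 {𝕜 : Type*} [RCLike 𝕜] {X : Type*} [NormedAddCommGroup X] [NormedSpace 𝕜 X]
    [CompleteSpace X] (p : ℝ) (hp : p ∈ Set.Icc (1 : ℝ) 2) :
    (HasRademacherType X p ↔ HasScaledEnfloType X p) ∧
      ENNReal.ofReal (1 / (2 * Real.pi)) * rademacherTypeConst X p ≤ scaledEnfloTypeConst X p ∧
      scaledEnfloTypeConst X p ≤ 5 * rademacherTypeConst X p := by
  let _ : NormedSpace ℝ X := NormedSpace.restrictScalars ℝ 𝕜 X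
  refine ⟨⟨fun ⟨T, hT⟩ => ⟨T, hT.hasScaledEnfloTypeWith hp.1⟩,
    fun ⟨τ, hτ⟩ => ⟨_, hτ.hasRademacherTypeWith hp.1⟩⟩, ?_, ?_⟩
  · refine le_iInf₂ fun τ hτ => ?_
    have h : rademacherTypeConst X p ≤ ENNReal.ofReal (2 * Real.pi) * τ := by
      refine (iInf₂_le _ (hτ.hasRademacherTypeWith hp.1)).trans_eq ?_
      rw [ENNReal.ofReal_mul (by norm_num), ENNReal.ofReal_ofNat]
      push_cast
      rfl
    refine (mul_le_mul_right h _).trans_eq ?_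
    rw [← mul_assoc, ← ENNReal.ofReal_mul (by positivity),
      one_div_mul_cancel (by positivity), ENNReal.ofReal_one, one_mul]
  · have h : scaledEnfloTypeConst X p ≤ rademacherTypeConst X p :=
      le_iInf₂ fun T hT => iInf₂_le T (hT.hasScaledEnfloTypeWith hp.1)
    exact h.trans (le_mul_of_one_le_left zero_le (by norm_num))
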